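/- **Setting.** Let $M$ be a space, $N\subset M$ a subspace triangulated as a finite-dimensional flag complex, and $\omega:M\to M$ a homeomorphism with $\omega^2=1$ that maps $N$ to itself by a simplicial automorphism; put $C_2=\langle\omega\rangle$. (For example, $M$ is a compact manifold with boundary $N=\partial M$.) Let $p:\widetilde M\to M$ be a surjective covering map with $\widetilde M$ simply connected, let $\widetilde N=p^{-1}(N)$ carry the lifted triangulation (the one for which $p:\widetilde N\to N$ is simplicial and injective on each simplex), and let $\Gamma$ be the group of all homeomorphisms of $\widetilde M$ that are lifts of elements of $C_2$. It acts on $\widetilde N$ by simplicial automorphisms. Let $\widetilde W$ be the right-angled Coxeter group with one generator $s_i$ for each vertex $i$ of $\widetilde N$ and relations $s_i^2=1$, and $(s_is_j)^2=1$ whenever $\{i,j\}$ spans an edge. $\Gamma$ acts on $\widetilde W$ by permuting the generators, written $w\mapsto w^\gamma$; form $\widetilde W\rtimes\Gamma$. For $x\in\widetilde M$ let $\widetilde W_x$ be the (special) subgroup generated by those $s_i$ for which $x$ lies in the closed star of $i$ in the barycentric subdivision of $\widetilde N$ (so $\widetilde W_x=1$ if $x\notin\widetilde N$). Let $$\mathcal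 U(\widetilde M,\widetilde N,\Gamma)=\widetilde W\times\widetilde M/\!\sim,\qquad (w,x)\sim(w',x')\iff x=x'\text{ and }w^{-1}w'\in\widetilde W_x,$$ with the action $(v,\gamma).[w,x]=[vw^\gamma,\gamma.x]$ of $\widetilde W\rtimes\Gamma$. **Proposition.** 1. Every subgroup $H$ of $\widetilde W\rtimes\Gamma$ that fixes some point of $\mathcal U(\widetilde M,\widetilde N,\Gamma)$ is finite. 2. If $x\in\widetilde M\setminus\widetilde N$ and $w\in\widetilde W$, then the stabilizer of $[w,x]$ in $\widetilde W\rtimes\Gamma$ is finite of order at most $2$. 3. If $y\in\widetilde N$ and $w\in\widetilde W$, then $\widetilde W_y$ is finite, the stabilizer $\Gamma_y$ of $y$ in $\Gamma$ has order at most $2$, and there is a short exact sequence $$1\to\widetilde W_y\to \mathrm{Stab}([w,y])\to\Gamma_y\to 1$$ whose first map is $v\mapsto(wvw^{-1},1)$ and whose second map is $(v,\gamma)\mapsto\gamma$. -/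

import Mathlib

noncomputable section

namespace ReflectionTrick

open scoped Classical

/-! ### Simplicial complexes, geometric realizations, triangulations -/

section Complexes

variable {V V' V'' : Type*}

/-- A flag complex: every nonempty finite set of vertices that are pairwise joined by edges
spans a simplex. -/
def IsFlag (K : AbstractSimplicialComplex V) : Prop :=
  ∀ s : Finset V, s.Nonempty → (∀ i ∈ s, ∀ j ∈ s, {i, j} ∈ K.faces) → s ∈ K.faces

/-- Finite dimensionality: the number of vertices of the simplices is bounded. -/
def IsFiniteDimensional (K : AbstractSimplicialComplex V) : Prop :=
  ∃ d : ℕ, ∀ s ∈ K.faces, s.card ≤ d + 1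

/-- The points of the geometric realization, given by their barycentric coordinates. -/
@[ext]
structure Realization (K : AbstractSimplicialComplex V) where
  coord : V →₀ ℝ
  support_mem : coord.support ∈ K.faces
  nonneg : ∀ i, 0 ≤ coord i
  sum_eq_one : (coord.sum fun _ t => t) = 1

/-- Simplicial maps between abstract simplicial complexes. -/
def IsSimplicialMap (K : AbstractSimplicialComplex V) (L : AbstractSimplicialComplex V')
    (q : V → V') : Prop :=
  ∀ s ∈ K.faces, s.image q ∈ L.faces

theorem support_mapDomain (q : V → V') (x : V →₀ ℝ) (hx : ∀ i, 0 ≤ x i) :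
    (x.mapDomain q).support = x.support.image q := by
  apply Finset.Subset.antisymm Finsupp.mapDomain_support
  intro j hj
  obtain ⟨i, hi, rfl⟩ := Finset.mem_image.1 hj
  rw [Finsupp.mem_support_iff, Finsupp.mapDomain, Finsupp.sum_apply, Finsupp.sum]
  have hpos : 0 < x i := lt_of_le_of_ne (hx i) (Ne.symm (Finsupp.mem_support_iff.1 hi))
  refine (lt_of_lt_of_le hpos ?_).ne'
  have h1 : (Finsupp.single (q i) (x i)) (q i) = x i := by simp
  calc x i = (Finsupp.single (q i) (x i)) (q i) := h1.symm
    _ ≤ _ := Finset.single_le_sum (f := fun a => (Finsupp.single (q a) (x a)) (q i))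
      (fun a _ => by
        simp only [Finsupp.single_apply]
        split_ifs
        · exact hx a
        · exact le_rfl) hi

theorem mapDomain_nonneg (q : V → V') (x : V →₀ ℝ) (hx : ∀ i, 0 ≤ x i) (j : V') :
    0 ≤ x.mapDomain q j := by
  rw [Finsupp.mapDomain, Finsupp.sum_apply, Finsupp.sum]
  refine Finset.sum_nonneg fun a _ => ?_
  simp only [Finsupp.single_apply]
  split_ifs
  · exact hx a
  · exact le_rfl

/-- The map of realizations that is induced by a simplicial map (it is affine on simplices). -/
def Realization.map {K : AbstractSimplicialComplex V} {L : AbstractSimplicialComplex V'}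
    (q : V → V') (hq : IsSimplicialMap K L q) (x : Realization K) : Realization L where
  coord := x.coord.mapDomain q
  support_mem := by
    rw [support_mapDomain q _ x.nonneg]
    exact hq _ x.support_mem
  nonneg := mapDomain_nonneg q _ x.nonneg
  sum_eq_one := by
    rw [Finsupp.sum_mapDomain_index (fun _ => rfl) (fun _ _ _ => rfl)]
    exact x.sum_eq_one

/-- The inclusion of the closed simplex spanned by a face `s`. -/
def faceMap (K : AbstractSimplicialComplex V) (s : K.faces) (z : stdSimplex ℝ s.1) :
    Realization K where
  coord := (Finsupp.equivFunOnFinite.symm (z : s.1 → ℝ)).mapDomain Subtype.val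
  support_mem := by
    rw [support_mapDomain _ _ z.2.1]
    refine (K.isRelLowerSet_faces s.2).2 ?_ ?_
    · intro i hi
      obtain ⟨j, -, rfl⟩ := Finset.mem_image.1 hi
      exact j.2
    · rw [Finset.image_nonempty, Finsupp.support_nonempty_iff]
      intro h0
      have h1 := z.2.2
      have h2 : ∀ i, z.1 i = 0 := fun i => DFunLike.congr_fun h0 i
      simp [h2] at h1
  nonneg := mapDomain_nonneg _ _ z.2.1
  sum_eq_one := by
    rw [Finsupp.sum_mapDomain_index (fun _ => rfl) (fun _ _ _ => rfl),
      Finsupp.sum_fintype _ _ (fun _ => rfl)]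
    exact z.2.2

/-- The weak topology: a set is open iff its intersection with every closed simplex is. -/
instance (K : AbstractSimplicialComplex V) : TopologicalSpace (Realization K) :=
  ⨆ s : K.faces, TopologicalSpace.coinduced (faceMap K s) inferInstance

theorem continuous_faceMap (K : AbstractSimplicialComplex V) (s : K.faces) :
    Continuous (faceMap K s) :=
  continuous_iff_coinduced_le.2
    (le_iSup (fun s : K.faces => TopologicalSpace.coinduced (faceMap K s) inferInstance) s)

/-- The barycenter of a simplex, in barycentric coordinates. -/
def barycenter (s : Finset V) : V →₀ ℝ := ∑ j ∈ s, Finsupp.single j ((s.card : ℝ)⁻¹)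

/-- The simplices of the barycentric subdivision: finite chains of simplices. -/
def IsSdSimplex (K : AbstractSimplicialComplex V) (c : Finset (Finset V)) : Prop :=
  c.Nonempty ∧ (∀ s ∈ c, s ∈ K.faces) ∧ IsChain (· ⊆ ·) (c : Set (Finset V))

/-- The closed star of the vertex `i` in the barycentric subdivision: the union of all simplices
of the subdivision having the vertex `{i}`. -/
def closedStar (K : AbstractSimplicialComplex V) (i : V) : Set (Realization K) :=
  {x | ∃ c, IsSdSimplex K c ∧ {i} ∈ c ∧
    x.coord ∈ convexHull ℝ (barycenter '' (c : Set (Finset V)))}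

/-- The group of automorphisms of a simplicial complex. -/
def autGroup (K : AbstractSimplicialComplex V) : Subgroup (Equiv.Perm V) where
  carrier := {π | ∀ s : Finset V, s.image π ∈ K.faces ↔ s ∈ K.faces}
  one_mem' := by
    intro s
    simp
  mul_mem' := by
    intro a b ha hb s
    rw [← hb s, ← ha (s.image b), Finset.image_image]
    rfl
  inv_mem' := by
    intro a ha s
    rw [← ha (s.image _), Finset.image_image]
    simp

theorem autGroup_isSimplicialMap {K : AbstractSimplicialComplex V} (π : autGroup K) :
    IsSimplicialMap K K π.1 :=
  fun s hs => (π.2 s).2 hs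

/-- A triangulation of the subspace `N`. -/
structure Triangulation (V : Type*) {X : Type*} [TopologicalSpace X] (N : Set X) where
  complex : AbstractSimplicialComplex V
  homeo : Realization complex ≃ₜ N

variable {X : Type*} [TopologicalSpace X] {N : Set X}

/-- The map `f` restricts to a simplicial automorphism of the triangulated subspace `N`. -/
def Triangulation.IsSimplicial (T : Triangulation V N) (f : X → X) : Prop :=
  ∃ π : autGroup T.complex, ∀ x : Realization T.complex,
    f (T.homeo x) = T.homeo (x.map π.1 (autGroup_isSimplicialMap π))

/-- The triangulation `T'` of the preimage of `N` under `p` is lifted from the triangulation `T`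
of `N`: with respect to `T'` and `T` the map `p` is simplicial, and it is injective on each
simplex. -/
def Triangulation.IsLift {Y : Type*} [TopologicalSpace Y] {p : Y → X}
    (T' : Triangulation V' (p ⁻¹' N)) (T : Triangulation V N) : Prop :=
  ∃ (q : V' → V) (hq : IsSimplicialMap T'.complex T.complex q),
    (∀ s ∈ T'.complex.faces, Set.InjOn q s) ∧
    ∀ x : Realization T'.complex, p (T'.homeo x) = T.homeo (x.map q hq)

end Complexes

/-! ### The right-angled Coxeter group of a simplicial complex -/

section Coxeter

variable {V : Type*} (K : AbstractSimplicialComplex V)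

/-- `m i i = 1`, and for `i ≠ j`, `m i j = 2` if `{i, j}` is an edge and `m i j = ∞` (encoded
by `0`) otherwise. -/
def coxeterMatrix : CoxeterMatrix V where
  M := fun i j => if i = j then 1 else if {i, j} ∈ K.faces then 2 else 0
  isSymm := by
    ext i j
    change (if j = i then 1 else if {j, i} ∈ K.faces then 2 else 0) =
      if i = j then 1 else if {i, j} ∈ K.faces then 2 else 0
    simp only [eq_comm (a := j), Finset.pair_comm j]
  diagonal i := by simp
  off_diagonal i j h := by
    simp only [h, if_false]
    split_ifs <;> decide

/-- The right-angled Coxeter group with one generator for every vertex, where the generators of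
adjacent vertices commute. -/
abbrev CoxGroup : Type _ := (coxeterMatrix K).Group

/-- The generator of the Coxeter group at the vertex `i`. -/
abbrev gen (i : V) : CoxGroup K := (coxeterMatrix K).simple i

theorem isLiftable_aut (π : autGroup K) :
    (coxeterMatrix K).IsLiftable fun i => gen K (π.1 i) := by
  intro i j
  have h : (coxeterMatrix K) i j = (coxeterMatrix K) (π.1 i) (π.1 j) := by
    have h1 := π.2 {i, j}
    rw [Finset.image_insert, Finset.image_singleton] at h1
    simp only [coxeterMatrix, h1, EmbeddingLike.apply_eq_iff_eq]
  rw [h]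
  exact (coxeterMatrix K).toCoxeterSystem.simple_mul_simple_pow (π.1 i) (π.1 j)

/-- The endomorphism of the Coxeter group with `s_i ↦ s_{π i}`. -/
def coxeterMap (π : autGroup K) : CoxGroup K →* CoxGroup K :=
  (coxeterMatrix K).toCoxeterSystem.lift ⟨_, isLiftable_aut K π⟩

theorem coxeterMap_gen (π : autGroup K) (i : V) : coxeterMap K π (gen K i) = gen K (π.1 i) :=
  (coxeterMatrix K).toCoxeterSystem.lift_apply_simple (isLiftable_aut K π) i

theorem coxeterMap_mul (π ρ : autGroup K) :
    coxeterMap K (π * ρ) = (coxeterMap K π).comp (coxeterMap K ρ) := by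
  refine (coxeterMatrix K).toCoxeterSystem.ext_simple fun i => ?_
  change coxeterMap K (π * ρ) (gen K i) = coxeterMap K π (coxeterMap K ρ (gen K i))
  simp only [coxeterMap_gen]
  rfl

theorem coxeterMap_one : coxeterMap K 1 = MonoidHom.id _ := by
  refine (coxeterMatrix K).toCoxeterSystem.ext_simple fun i => ?_
  change coxeterMap K 1 (gen K i) = gen K i
  simp only [coxeterMap_gen]
  rfl

/-- The automorphisms of the complex act on the Coxeter group by permuting the generators. -/
def coxeterAut : autGroup K →* MulAut (CoxGroup K) where
  toFun π :=
    { coxeterMap K π with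
      invFun := coxeterMap K π⁻¹
      left_inv := fun w => by
        have h := DFunLike.congr_fun (coxeterMap_mul K π⁻¹ π) w
        rw [inv_mul_cancel, coxeterMap_one] at h
        exact h.symm
      right_inv := fun w => by
        have h := DFunLike.congr_fun (coxeterMap_mul K π π⁻¹) w
        rw [mul_inv_cancel, coxeterMap_one] at h
        exact h.symm }
  map_one' := MulEquiv.ext fun w => DFunLike.congr_fun (coxeterMap_one K) w
  map_mul' π ρ := MulEquiv.ext fun w => DFunLike.congr_fun (coxeterMap_mul K π ρ) w

theorem coxeterAut_gen (π : autGroup K) (i : V) :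
    coxeterAut K π (gen K i) = gen K (π.1 i) :=
  coxeterMap_gen K π i

end Coxeter

/-! ### The equivariant reflection group trick -/

section Vertices

variable {V : Type*}

/-- The point of the realization given by a vertex. -/
def vertexPoint (K : AbstractSimplicialComplex V) (i : V) : Realization K where
  coord := Finsupp.single i 1
  support_mem := by
    rw [show (Finsupp.single i (1 : ℝ)).support = {i} by simp [Finsupp.support_single]]
    exact K.singleton_mem i
  nonneg := fun j => by
    rw [Finsupp.single_apply]
    split_ifs <;> norm_num
  sum_eq_one := by simp

theorem vertexPoint_injective (K : AbstractSimplicialComplex V) :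
    Function.Injective (vertexPoint K) := fun _ _ h =>
  Finsupp.single_left_injective (one_ne_zero (α := ℝ)) (congrArg Realization.coord h)

theorem map_vertexPoint {V' : Type*} {K : AbstractSimplicialComplex V}
    {L : AbstractSimplicialComplex V'} (q : V → V') (hq : IsSimplicialMap K L q) (i : V) :
    (vertexPoint K i).map q hq = vertexPoint L (q i) := by
  ext1
  exact Finsupp.mapDomain_single

theorem barycenter_image (π : Equiv.Perm V) (s : Finset V) :
    (barycenter s).mapDomain π = barycenter (s.image π) := by
  rw [barycenter, barycenter, Finset.card_image_of_injective _ π.injective,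
    Finset.sum_image (fun a _ b _ h => π.injective h), Finsupp.mapDomain_finsetSum]
  simp only [Finsupp.mapDomain_single]

theorem map_mem_closedStar {K : AbstractSimplicialComplex V} (π : autGroup K) (i : V)
    {x : Realization K} (hx : x ∈ closedStar K i) :
    x.map π.1 (autGroup_isSimplicialMap π) ∈ closedStar K (π.1 i) := by
  obtain ⟨c, ⟨hne, hc, hchain⟩, hic, hxc⟩ := hx
  refine ⟨c.image (fun s => s.image π.1), ⟨hne.image _, ?_, ?_⟩, ?_, ?_⟩
  · intro t ht
    obtain ⟨s, hs, rfl⟩ := Finset.mem_image.1 ht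
    exact (π.2 s).2 (hc s hs)
  · intro t ht t' ht' hne'
    obtain ⟨s, hs, rfl⟩ := Finset.mem_image.1 (Finset.mem_coe.1 ht)
    obtain ⟨s', hs', rfl⟩ := Finset.mem_image.1 (Finset.mem_coe.1 ht')
    have hss : s ≠ s' := fun h => hne' (by rw [h])
    exact (hchain hs hs' hss).imp (fun h => Finset.image_subset_image h)
      (fun h => Finset.image_subset_image h)
  · exact Finset.mem_image.2 ⟨{i}, hic, Finset.image_singleton _ _⟩
  · have h := Set.mem_image_of_mem (Finsupp.lmapDomain ℝ ℝ (π.1 : V → V)) hxc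
    rw [LinearMap.image_convexHull, Set.image_image] at h
    simp only [Finsupp.lmapDomain_apply, barycenter_image] at h
    rw [Finset.coe_image, Set.image_image]
    exact h

end Vertices

/-- The input of the construction: a space `X`, a triangulated subspace `N`, and an action of the
group `G` on `X` by homeomorphisms that restrict to simplicial automorphisms of `N`. -/
structure Datum (V X G : Type*) [TopologicalSpace X] [Group G] where
  N : Set X
  tri : Triangulation V N
  act : G →* (X ≃ₜ X)
  simplicial : ∀ g, tri.IsSimplicial (act g)

namespace Datum

variable {V X G : Type*} [TopologicalSpace X] [Group G] (D : Datum V X G)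

/-- The automorphism of the complex by which a group element acts. -/
def aut (g : G) : autGroup D.tri.complex := (D.simplicial g).choose

theorem act_homeo (g : G) (x : Realization D.tri.complex) :
    D.act g (D.tri.homeo x) =
      D.tri.homeo (x.map (D.aut g).1 (autGroup_isSimplicialMap (D.aut g))) :=
  (D.simplicial g).choose_spec x

theorem aut_unique {g : G} {j i : V}
    (h : D.act g (D.tri.homeo (vertexPoint _ i)) = D.tri.homeo (vertexPoint _ j)) :
    (D.aut g).1 i = j := by
  rw [act_homeo, map_vertexPoint] at h
  exact vertexPoint_injective _ (D.tri.homeo.injective (Subtype.ext h))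

/-- The group acts on the complex by automorphisms. -/
def autHom : G →* autGroup D.tri.complex where
  toFun := D.aut
  map_one' := by
    refine Subtype.ext (Equiv.ext fun i => D.aut_unique ?_)
    rw [map_one]
    rfl
  map_mul' g h := by
    refine Subtype.ext (Equiv.ext fun i => D.aut_unique ?_)
    rw [map_mul, Homeomorph.mul_apply, act_homeo, map_vertexPoint, act_homeo, map_vertexPoint]
    rfl

/-- The right-angled Coxeter group `W`. -/
abbrev W : Type _ := CoxGroup D.tri.complex

/-- The action of `G` on `W`, written `w ^ g` in the semidirect product. -/
def φ : G →* MulAut D.W := (coxeterAut D.tri.complex).comp D.autHom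

/-- The semidirect product `W ⋊ G`. -/
abbrev WG : Type _ := D.W ⋊[D.φ] G

/-- The set `σ(x)` of the vertices `i` such that `x` lies in the closed star of `i` in the
barycentric subdivision of `N`; it is empty if `x` is not in `N`. -/
def sigma (x : X) : Set V := {i | x ∈ (fun y => (D.tri.homeo y : X)) '' closedStar D.tri.complex i}

/-- The special subgroup `W_x`, generated by the `s_i` with `i ∈ σ(x)`. -/
def special (x : X) : Subgroup D.W := Subgroup.closure (gen D.tri.complex '' D.sigma x)

theorem sigma_act (g : G) (x : X) {i : V} (hi : i ∈ D.sigma x) :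
    (D.aut g).1 i ∈ D.sigma (D.act g x) := by
  obtain ⟨y, hy, rfl⟩ := hi
  exact ⟨_, map_mem_closedStar _ _ hy, (D.act_homeo g y).symm⟩

theorem special_act (g : G) (x : X) {w : D.W} (hw : w ∈ D.special x) :
    D.φ g w ∈ D.special (D.act g x) := by
  have h : D.special x ≤ (D.special (D.act g x)).comap (D.φ g).toMonoidHom := by
    rw [special, Subgroup.closure_le]
    rintro _ ⟨i, hi, rfl⟩
    refine Subgroup.subset_closure ⟨(D.aut g).1 i, D.sigma_act g x hi, ?_⟩
    exact (coxeterAut_gen _ _ _).symm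
  exact h hw

/-- `(w, x) ∼ (w', x')` iff `x = x'` and `w⁻¹ w' ∈ W_x`. -/
def setoid : Setoid (D.W × X) where
  r a b := a.2 = b.2 ∧ a.1⁻¹ * b.1 ∈ D.special a.2
  iseqv :=
    { refl := fun a => ⟨rfl, by rw [inv_mul_cancel]; exact one_mem _⟩
      symm := fun {a b} h => ⟨h.1.symm, by
        have := inv_mem h.2
        rwa [mul_inv_rev, inv_inv, h.1] at this⟩
      trans := fun {a b c} h h' => ⟨h.1.trans h'.1, by
        have h2 := h'.2
        rw [← h.1] at h2
        have := mul_mem h.2 h2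
        rwa [mul_assoc, mul_inv_cancel_left] at this⟩ }

/-- The space `𝒰(X, N, G) = W × X / ∼`. -/
def U : Type _ := Quotient D.setoid

/-- The point `[w, x]`. -/
def point (w : D.W) (x : X) : D.U := Quotient.mk D.setoid (w, x)

/-- The quotient topology, where `W` is discrete. -/
instance : TopologicalSpace D.U :=
  ⨆ w : D.W, TopologicalSpace.coinduced (D.point w) inferInstance

/-- The action `(v, g) • [w, x] = [v w ^ g, g x]`. -/
instance : MulAction D.WG D.U where
  smul a := Quotient.map (fun b => (a.left * D.φ a.right b.1, D.act a.right b.2)) (by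
    rintro ⟨w, x⟩ ⟨w', x'⟩ ⟨h1, h2⟩
    dsimp only at h1 h2
    subst h1
    refine ⟨rfl, ?_⟩
    have h := D.special_act a.right x h2
    rw [map_mul, map_inv] at h
    dsimp only
    rwa [mul_inv_rev, mul_assoc, inv_mul_cancel_left])
  one_smul u := by
    induction u using Quotient.inductionOn with
    | h b =>
      change Quotient.mk _ _ = Quotient.mk _ _
      congr 1
      ext <;> simp
  mul_smul a a' u := by
    induction u using Quotient.inductionOn with
    | h b =>
      change Quotient.mk _ _ = Quotient.mk _ _
      congr 1
      ext <;> simp [mul_assoc]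

theorem smul_point (v : D.W) (g : G) (w : D.W) (x : X) :
    (⟨v, g⟩ : D.WG) • D.point w x = D.point (v * D.φ g w) (D.act g x) :=
  rfl

/-- The stabilizer `G_x` in `G` of the point `x`. -/
def stab (x : X) : Subgroup G where
  carrier := {g | D.act g x = x}
  one_mem' := by
    change D.act 1 x = x
    rw [map_one]
    rfl
  mul_mem' := by
    intro a b ha hb
    change D.act (a * b) x = x
    rw [map_mul, Homeomorph.mul_apply, hb, ha]
  inv_mem' := by
    intro a ha
    change D.act a⁻¹ x = x
    rw [map_inv, Homeomorph.inv_apply, Homeomorph.symm_apply_eq]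
    exact ha.symm

end Datum

/-! ### Lifting a group action to a covering space -/

section Lifting

variable {X Y : Type*} [TopologicalSpace X] [TopologicalSpace Y]

/-- The group of all homeomorphisms of `Y` that are lifts along `p` of elements of `C`. -/
def liftGroup (p : Y → X) (C : Subgroup (X ≃ₜ X)) : Subgroup (Y ≃ₜ Y) where
  carrier := {γ | ∃ g ∈ C, ∀ y, p (γ y) = g (p y)}
  one_mem' := ⟨1, C.one_mem, fun _ => rfl⟩
  mul_mem' := by
    rintro a b ⟨g, hg, hga⟩ ⟨h, hh, hhb⟩
    exact ⟨g * h, C.mul_mem hg hh, fun y => by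
      rw [Homeomorph.mul_apply, hga, hhb, Homeomorph.mul_apply]⟩
  inv_mem' := by
    rintro a ⟨g, hg, hga⟩
    refine ⟨g⁻¹, C.inv_mem hg, fun y => ?_⟩
    rw [Homeomorph.inv_apply, Homeomorph.inv_apply, eq_comm, Homeomorph.symm_apply_eq, ← hga,
      Homeomorph.apply_symm_apply]

variable {V V' : Type*} {N : Set X}

theorem isSimplicial_inv {T : Triangulation V N} {g : X ≃ₜ X} (hg : T.IsSimplicial g) :
    T.IsSimplicial (g⁻¹ : X ≃ₜ X) := by
  obtain ⟨π, hπ⟩ := hg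
  refine ⟨π⁻¹, fun x => ?_⟩
  rw [Homeomorph.inv_apply, Homeomorph.symm_apply_eq, hπ]
  congr 2
  ext1
  simp only [Realization.map]
  rw [← Finsupp.mapDomain_comp]
  have h : (⇑π.1 ∘ ⇑(π⁻¹).1 : V → V) = id := by
    funext i
    simp
  rw [h, Finsupp.mapDomain_id]

theorem isSimplicial_of_mem_zpowers {T : Triangulation V N} {ω : X ≃ₜ X}
    (hω : T.IsSimplicial ω) {g : X ≃ₜ X} (hg : g ∈ Subgroup.zpowers ω) : T.IsSimplicial g := by
  rw [Subgroup.zpowers_eq_closure] at hg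
  induction hg using Subgroup.closure_induction with
  | mem g hg => rwa [Set.mem_singleton_iff.1 hg]
  | one =>
    refine ⟨1, fun x => ?_⟩
    rw [Homeomorph.one_apply]
    congr 2
    ext1
    exact Finsupp.mapDomain_id.symm
  | mul a b _ _ ha hb =>
    obtain ⟨π, hπ⟩ := ha
    obtain ⟨ρ, hρ⟩ := hb
    refine ⟨π * ρ, fun x => ?_⟩
    rw [Homeomorph.mul_apply, hρ, hπ]
    congr 2
    ext1
    exact Finsupp.mapDomain_comp.symm
  | inv a _ ha => exact isSimplicial_inv ha

/-- The barycenter of a simplex, as a point of the realization. -/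
theorem exists_support_eq (K : AbstractSimplicialComplex V) (s : K.faces) :
    ∃ z : stdSimplex ℝ s.1, (faceMap K s z).coord.support = s.1 := by
  have hs : s.1.Nonempty := (K.isRelLowerSet_faces s.2).1
  have : Nonempty s.1 := hs.to_subtype
  have hc : (0 : ℝ) < (Fintype.card s.1 : ℝ)⁻¹ := inv_pos.2 (Nat.cast_pos.2 Fintype.card_pos)
  refine ⟨⟨fun _ => (Fintype.card s.1 : ℝ)⁻¹, fun _ => hc.le, ?_⟩, ?_⟩
  · rw [Finset.sum_const, Finset.card_univ, nsmul_eq_mul]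
    exact mul_inv_cancel₀ (inv_pos.1 hc).ne'
  · rw [faceMap, support_mapDomain _ _ (fun _ => hc.le)]
    ext i
    simp only [Finset.mem_image, Finsupp.mem_support_iff]
    exact ⟨fun ⟨j, _, h⟩ => h ▸ j.2, fun h => ⟨⟨i, h⟩, hc.ne', rfl⟩⟩

theorem exists_faceMap (K : AbstractSimplicialComplex V) (s : K.faces) (x : Realization K)
    (hx : x.coord.support ⊆ s.1) : ∃ z, faceMap K s z = x := by
  refine ⟨⟨fun i => x.coord i.1, fun i => x.nonneg i.1, ?_⟩, ?_⟩
  · rw [Finset.sum_coe_sort s.1 (fun i => x.coord i), ← x.sum_eq_one]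
    exact (Finsupp.sum_of_support_subset x.coord hx (fun _ t => t) (fun _ _ => rfl)).symm
  · ext i
    by_cases hi : i ∈ s.1
    · exact Finsupp.mapDomain_apply Subtype.val_injective _ (⟨i, hi⟩ : s.1)
    · have h1 : x.coord i = 0 := by
        by_contra h
        exact hi (hx (Finsupp.mem_support_iff.2 h))
      rw [h1]
      exact Finsupp.mapDomain_of_notMem_range _ _ (by simpa using hi)

/-- On each simplex, a lift of a simplicial homeomorphism is given by a map of vertices. -/
theorem lift_on_face {p : Y → X} (hp : IsCoveringMap p) {T : Triangulation V N}
    {T' : Triangulation V' (p ⁻¹' N)} (hT : T'.IsLift T) {g : X ≃ₜ X} (hg : T.IsSimplicial g)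
    {γ : Y ≃ₜ Y} (hγ : ∀ y, p (γ y) = g (p y)) (s : T'.complex.faces) :
    ∃ f : V' → V', s.1.image f ∈ T'.complex.faces ∧
      ∀ x : Realization T'.complex, x.coord.support ⊆ s.1 →
        ∃ x' : Realization T'.complex, x'.coord = x.coord.mapDomain f ∧
          γ (T'.homeo x) = T'.homeo x' := by
  obtain ⟨q, hq, hinj, hpq⟩ := hT
  obtain ⟨π, hπ⟩ := hg
  have hs : s.1.Nonempty := (T'.complex.isRelLowerSet_faces s.2).1
  have : Nonempty s.1 := hs.to_subtype
  obtain ⟨z₀, hz₀⟩ := exists_support_eq T'.complex s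
  have hgp : ∀ x : Realization T'.complex, p (γ (T'.homeo x)) =
      T.homeo ((x.map q hq).map π.1 (autGroup_isSimplicialMap π)) := fun x => by
    rw [hγ, hpq, hπ]
  have hmem : γ (T'.homeo (faceMap _ s z₀)) ∈ p ⁻¹' N := by
    rw [Set.mem_preimage, hgp]
    exact Subtype.coe_prop _
  obtain ⟨x', hx'⟩ := T'.homeo.surjective ⟨_, hmem⟩
  have hx'' : (T'.homeo x' : Y) = γ (T'.homeo (faceMap _ s z₀)) := congrArg Subtype.val hx'
  have hcoord : x'.coord.mapDomain q =
      ((faceMap _ s z₀).coord.mapDomain q).mapDomain π.1 := by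
    have h := hgp (faceMap _ s z₀)
    rw [← hx'', hpq] at h
    exact congrArg Realization.coord (T.homeo.injective (Subtype.ext h))
  have hsupp : x'.coord.support.image q = (s.1.image q).image π.1 := by
    have h := congrArg Finsupp.support hcoord
    rwa [support_mapDomain _ _ x'.nonneg,
      support_mapDomain _ _ (mapDomain_nonneg _ _ (Realization.nonneg _)),
      support_mapDomain _ _ (Realization.nonneg _), hz₀] at h
  set t : T'.complex.faces := ⟨x'.coord.support, x'.support_mem⟩ with ht
  have hex : ∀ i : s.1, ∃ j : t.1, q j.1 = π.1 (q i.1) := fun i => by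
    have h : π.1 (q i.1) ∈ x'.coord.support.image q := by
      rw [hsupp]
      exact Finset.mem_image_of_mem _ (Finset.mem_image_of_mem _ i.2)
    obtain ⟨j, hj, hj'⟩ := Finset.mem_image.1 h
    exact ⟨⟨j, hj⟩, hj'⟩
  choose e he using hex
  set f : V' → V' := fun i => if h : i ∈ s.1 then (e ⟨i, h⟩).1 else i with hf
  have hfe : ∀ i : s.1, f i.1 = (e i).1 := fun i => by simp [hf]
  have hfq : ∀ i ∈ s.1, q (f i) = π.1 (q i) := fun i hi => by
    rw [hfe ⟨i, hi⟩, he]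
  have hft : s.1.image f ⊆ t.1 := by
    intro j hj
    obtain ⟨i, hi, rfl⟩ := Finset.mem_image.1 hj
    rw [hfe ⟨i, hi⟩]
    exact (e _).2
  have hmap : ∀ z : stdSimplex ℝ s.1, (faceMap T'.complex t (stdSimplex.map e z)).coord =
      (faceMap T'.complex s z).coord.mapDomain f := fun z => by
    simp only [faceMap]
    rw [← Finsupp.mapDomain_comp]
    have h1 : (f ∘ Subtype.val : s.1 → V') = Subtype.val ∘ e := funext hfe
    rw [h1, Finsupp.mapDomain_comp]
    congr 1
    ext j
    rfl
  have hkey : (fun z => γ (T'.homeo (faceMap _ s z))) =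
      fun z => (T'.homeo (faceMap _ t (stdSimplex.map e z)) : Y) := by
    refine hp.eq_of_comp_eq ?_ ?_ ?_ z₀ ?_
    · exact γ.continuous.comp (continuous_subtype_val.comp
        (T'.homeo.continuous.comp (continuous_faceMap _ s)))
    · exact continuous_subtype_val.comp (T'.homeo.continuous.comp
        ((continuous_faceMap _ t).comp (stdSimplex.continuous_map e)))
    · funext z
      simp only [Function.comp_apply]
      rw [hgp, hpq]
      congr 2
      ext1
      simp only [Realization.map, hmap]
      rw [← Finsupp.mapDomain_comp, ← Finsupp.mapDomain_comp]
      refine Finsupp.mapDomain_congr fun i hi => ?_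
      have his : i ∈ s.1 := by
        have h := support_mapDomain (Subtype.val : s.1 → V')
          (Finsupp.equivFunOnFinite.symm (z : s.1 → ℝ)) z.2.1
        have hi' : i ∈ (Finsupp.mapDomain (Subtype.val : s.1 → V')
          (Finsupp.equivFunOnFinite.symm (z : s.1 → ℝ))).support := hi
        rw [h] at hi'
        obtain ⟨j, -, rfl⟩ := Finset.mem_image.1 hi'
        exact j.2
      exact (hfq i his).symm
    · rw [← hx'']
      congr 2
      ext1
      rw [hmap]
      refine Finsupp.mapDomain_injOn (t.1 : Set V') (hinj _ t.2) ?_ ?_ ?_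
      · exact fun _ h => h
      · intro i hi
        have := Finsupp.mapDomain_support hi
        rw [hz₀] at this
        exact hft this
      · rw [hcoord, ← Finsupp.mapDomain_comp, ← Finsupp.mapDomain_comp]
        refine Finsupp.mapDomain_congr fun i hi => ?_
        rw [hz₀] at hi
        exact (hfq i hi).symm
  refine ⟨f, (T'.complex.isRelLowerSet_faces t.2).2 hft (hs.image _), fun x hx => ?_⟩
  obtain ⟨z, rfl⟩ := exists_faceMap _ s x hx
  exact ⟨_, hmap z, congrFun hkey z⟩

theorem isSimplicial_lift {p : Y → X} (hp : IsCoveringMap p) {T : Triangulation V N}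
    {T' : Triangulation V' (p ⁻¹' N)} (hT : T'.IsLift T) {g : X ≃ₜ X} (hg : T.IsSimplicial g)
    {γ : Y ≃ₜ Y} (hγ : ∀ y, p (γ y) = g (p y)) : T'.IsSimplicial γ := by
  have main : ∀ (g : X ≃ₜ X) (γ : Y ≃ₜ Y), T.IsSimplicial g → (∀ y, p (γ y) = g (p y)) →
      ∃ f : V' → V', IsSimplicialMap T'.complex T'.complex f ∧
        ∀ x : Realization T'.complex, ∃ x' : Realization T'.complex,
          x'.coord = x.coord.mapDomain f ∧ γ (T'.homeo x) = T'.homeo x' := by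
    intro g γ hg hγ
    choose F hF hF' using lift_on_face hp hT hg hγ
    set f : V' → V' := fun i => F ⟨{i}, T'.complex.singleton_mem i⟩ i with hf
    have hfF : ∀ (s : T'.complex.faces), ∀ i ∈ s.1, F s i = f i := by
      intro s i hi
      have hsup : ∀ r : Finset V', i ∈ r → (vertexPoint T'.complex i).coord.support ⊆ r := by
        intro r hr
        refine Finsupp.support_single_subset.trans ?_
        simpa using hr
      obtain ⟨x, hx, hx'⟩ := hF' s (vertexPoint _ i) (hsup _ hi)
      obtain ⟨y, hy, hy'⟩ := hF' ⟨{i}, T'.complex.singleton_mem i⟩ (vertexPoint _ i)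
        (hsup _ (Finset.mem_singleton_self i))
      have hxy : x = y := T'.homeo.injective (Subtype.ext (hx'.symm.trans hy'))
      rw [hxy, hy] at hx
      simp only [vertexPoint, Finsupp.mapDomain_single] at hx
      exact (Finsupp.single_left_injective one_ne_zero hx).symm
    refine ⟨f, fun s hs => ?_, fun x => ?_⟩
    · rw [← Finset.image_congr (hfF ⟨s, hs⟩)]
      exact hF ⟨s, hs⟩
    · obtain ⟨x', h1, h2⟩ := hF' ⟨_, x.support_mem⟩ x (Finset.Subset.refl _)
      exact ⟨x', h1.trans (Finsupp.mapDomain_congr (hfF ⟨_, x.support_mem⟩)), h2⟩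
  obtain ⟨f, hf, hf'⟩ := main g γ hg hγ
  obtain ⟨k, hk, hk'⟩ := main g⁻¹ γ⁻¹ (isSimplicial_inv hg) (fun y => by
    rw [Homeomorph.inv_apply, Homeomorph.inv_apply, eq_comm, Homeomorph.symm_apply_eq, ← hγ,
      Homeomorph.apply_symm_apply])
  have hcomp : ∀ (γ₁ γ₂ : Y ≃ₜ Y) (f₁ f₂ : V' → V'), (∀ y, γ₂ (γ₁ y) = y) →
      (∀ x : Realization T'.complex, ∃ x' : Realization T'.complex,
          x'.coord = x.coord.mapDomain f₁ ∧ γ₁ (T'.homeo x) = T'.homeo x') →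
      (∀ x : Realization T'.complex, ∃ x' : Realization T'.complex,
          x'.coord = x.coord.mapDomain f₂ ∧ γ₂ (T'.homeo x) = T'.homeo x') →
      ∀ i, f₂ (f₁ i) = i := by
    intro γ₁ γ₂ f₁ f₂ hγ' h₁ h₂ i
    obtain ⟨x, hx, hx'⟩ := h₁ (vertexPoint _ i)
    obtain ⟨y, hy, hy'⟩ := h₂ x
    have hxy : vertexPoint _ i = y := T'.homeo.injective (Subtype.ext (by
      rw [← hy', ← hx', hγ']))
    rw [← hxy, hx] at hy
    simp only [vertexPoint, Finsupp.mapDomain_single] at hy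
    exact (Finsupp.single_left_injective one_ne_zero hy).symm
  let e : Equiv.Perm V' :=
    { toFun := f
      invFun := k
      left_inv := hcomp γ γ⁻¹ f k (fun y => γ.symm_apply_apply y) hf' hk'
      right_inv := hcomp γ⁻¹ γ k f (fun y => γ.apply_symm_apply y) hk' hf' }
  refine ⟨⟨e, fun s => ⟨fun h => ?_, hf s⟩⟩, fun x => ?_⟩
  · have h1 := hk _ h
    rw [Finset.image_image] at h1
    have h2 : k ∘ ⇑e = id := funext e.left_inv
    rwa [h2, Finset.image_id] at h1
  · obtain ⟨x', h1, h2⟩ := hf' x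
    rw [h2]
    congr 2
    ext1
    exact h1

/-- The datum for the reflection trick on the covering space: the triangulated preimage of `N`,
with the group of all lifts of the powers of `ω`. -/
def liftDatum {p : Y → X} (hp : IsCoveringMap p) {T : Triangulation V N} {ω : X ≃ₜ X}
    (hω : T.IsSimplicial ω) (T' : Triangulation V' (p ⁻¹' N)) (hT : T'.IsLift T) :
    Datum V' Y (liftGroup p (Subgroup.zpowers ω)) where
  N := p ⁻¹' N
  tri := T'
  act := (liftGroup p (Subgroup.zpowers ω)).subtype
  simplicial γ := by
    obtain ⟨g, hg, hγ⟩ := γ.2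
    exact isSimplicial_lift hp hT (isSimplicial_of_mem_zpowers hω hg) hγ

end Lifting

end ReflectionTrick

end

namespace ReflectionTrick

/-! ### Point stabilizers -/

/-! An element (v, γ) fixes [w, x] exactly when γ fixes x and w⁻¹ v w^γ lies in W_x. Projecting to γ
therefore maps the stabilizer to the stabilizer Γ_x; the kernel is the conjugate w W_x w⁻¹, and
every γ in Γ_x is hit. This gives the extension of Γ_x by W_x for every x (`stabilizerExtension`),
and all three assertions follow once both ends are bounded.

The kernel: a closed star of a vertex i in the barycentric subdivision lies where the i-th
barycentric coordinate is positive, so all vertices of σ(x) belong to the simplex carrying x. Hence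
W_x is generated by finitely many commuting involutions and is finite (`finite_special`); off N it
is trivial.

The quotient: a lift that fixes x is determined by the power of ω that it covers, by uniqueness of
lifts to the connected covering space. So Γ_x injects, as a set, into ⟨ω⟩, which has at most two
elements (`finite_and_card_stab_liftDatum_le`). -/

/-! ### Commuting involutions and closed stars -/

/-- A subgroup generated by finitely many pairwise commuting involutions is finite. -/
theorem finite_closure_of_commute_of_sq_eq_one {G : Type*} [Group G] {s : Set G} (hs : s.Finite)
    (hcomm : ∀ a ∈ s, ∀ b ∈ s, a * b = b * a) (hsq : ∀ a ∈ s, a * a = 1) :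
    Finite (Subgroup.closure s) := by
  let _ : CommGroup (Subgroup.closure s) :=
    { (inferInstance : Group (Subgroup.closure s)) with
      mul_comm := (Subgroup.isMulCommutative_closure hcomm).is_comm.comm }
  have : Group.FG (Subgroup.closure s) := by
    have : Finite s := hs
    exact Group.closure_finite_fg s
  -- A finitely generated abelian torsion group is finite; here every element squares to 1, since by
  -- commutativity this passes from the generators to products.
  refine CommGroup.finite_of_fg_isMulTorsion _ fun a => isOfFinOrder_iff_pow_eq_one.2 ⟨2, two_pos, ?_⟩
  obtain ⟨a, ha⟩ := a
  refine Subtype.ext ?_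
  change a ^ 2 = 1
  induction ha using Subgroup.closure_induction with
  | mem a ha => rw [sq, hsq a ha]
  | one => exact one_pow 2
  | mul a b ha hb iha ihb =>
    have hab : a * b = b * a :=
      congrArg Subtype.val (mul_comm (⟨a, ha⟩ : Subgroup.closure s) ⟨b, hb⟩)
    rw [Commute.mul_pow hab, iha, ihb, one_mul]
  | inv a _ iha => rw [inv_pow, iha, inv_one]

theorem barycenter_pos {V : Type*} {s : Finset V} {i : V} (hi : i ∈ s) : 0 < barycenter s i := by
  classical
  rw [barycenter, Finsupp.finsetSum_apply]
  simp only [Finsupp.single_apply]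
  rw [Finset.sum_ite_eq' s i, if_pos hi]
  exact inv_pos.2 (Nat.cast_pos.2 (Finset.card_pos.2 ⟨i, hi⟩))

/-- A point in the closed star of the vertex `i` in the barycentric subdivision has a positive
`i`-th barycentric coordinate. -/
theorem mem_support_of_mem_closedStar {V : Type*} {K : AbstractSimplicialComplex V} {i : V}
    {x : Realization K} (hx : x ∈ closedStar K i) : i ∈ x.coord.support := by
  obtain ⟨c, ⟨-, hc, hchain⟩, hic, hxc⟩ := hx
  -- The open half-space where the i-th coordinate is positive is convex, so it suffices that it
  -- contains each barycenter of the chain.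
  have hpos : convexHull ℝ (barycenter '' (c : Set (Finset V))) ⊆ {z | 0 < z i} := by
    refine convexHull_min ?_ (convex_halfSpace_gt (f := fun z : V →₀ ℝ => z i)
      ⟨fun _ _ => rfl, fun _ _ => rfl⟩ 0)
    rintro _ ⟨s, hs, rfl⟩
    refine barycenter_pos ?_
    -- Each s in the chain is comparable with {i}; since s is nonempty, it contains i in either
    -- case.
    rcases hchain.total hic hs with h | h
    · exact Finset.singleton_subset_iff.1 h
    · rw [((K.isRelLowerSet_faces (hc s hs)).1.subset_singleton_iff).1 h]
      exact Finset.mem_singleton_self i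
  exact Finsupp.mem_support_iff.2 (hpos hxc).ne'

theorem gen_mul_self {V : Type*} (K : AbstractSimplicialComplex V) (i : V) :
    gen K i * gen K i = 1 :=
  (coxeterMatrix K).toCoxeterSystem.simple_mul_simple_self i

open scoped Classical in
/-- The generators of adjacent vertices commute. -/
theorem gen_mul_comm {V : Type*} {K : AbstractSimplicialComplex V} {i j : V}
    (h : {i, j} ∈ K.faces) : gen K i * gen K j = gen K j * gen K i := by
  by_cases hij : i = j
  · rw [hij]
  have h1 : (gen K i * gen K j) ^ (coxeterMatrix K) i j = 1 :=
    (coxeterMatrix K).toCoxeterSystem.simple_mul_simple_pow i j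
  have h2 : (coxeterMatrix K) i j = 2 := by
    change (if i = j then 1 else if {i, j} ∈ K.faces then 2 else 0) = 2
    rw [if_neg hij, if_pos h]
  rw [h2, sq] at h1
  -- As (s_i s_j)² = 1, the product s_i s_j is its own inverse, which is s_j s_i because the
  -- generators are involutions.
  rw [eq_inv_of_mul_eq_one_left h1, mul_inv_rev, inv_eq_of_mul_eq_one_left (gen_mul_self K i),
    inv_eq_of_mul_eq_one_left (gen_mul_self K j)]

/-! ### Stabilizers of points of 𝒰 for a general datum -/

namespace Datum

variable {V X G : Type*} [TopologicalSpace X] [Group G] (D : Datum V X G)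

theorem sigma_eq_empty {x : X} (hx : x ∉ D.N) : D.sigma x = ∅ := by
  refine Set.eq_empty_of_forall_notMem ?_
  rintro i ⟨y, -, rfl⟩
  exact hx (D.tri.homeo y).2

theorem special_eq_bot {x : X} (hx : x ∉ D.N) : D.special x = ⊥ := by
  rw [special, D.sigma_eq_empty hx, Set.image_empty, Subgroup.closure_empty]

/-- The vertices in `σ(x)` are vertices of a common simplex. -/
theorem exists_sigma_subset {x : X} (hx : x ∈ D.N) :
    ∃ s ∈ D.tri.complex.faces, D.sigma x ⊆ (s : Set V) := by
  obtain ⟨z, hz⟩ := D.tri.homeo.surjective ⟨x, hx⟩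
  refine ⟨_, z.support_mem, ?_⟩
  rintro i ⟨y, hy, hyx⟩
  -- The point y witnessing membership in the star lies over x, so it is z itself: one carrier
  -- simplex serves all i in σ(x).
  have hyz : y = z := D.tri.homeo.injective (Subtype.ext (hyx.trans (congrArg Subtype.val hz).symm))
  exact hyz ▸ mem_support_of_mem_closedStar hy

/-- The vertices in σ(x) span faces of one finite simplex, so their generators are finitely many and
commute pairwise. -/
theorem finite_special (x : X) : Finite (D.special x) := by
  by_cases hx : x ∈ D.N
  · obtain ⟨s, hs, hσ⟩ := D.exists_sigma_subset hx
    refine finite_closure_of_commute_of_sq_eq_one ((s.finite_toSet.subset hσ).image _) ?_ ?_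
    · rintro _ ⟨i, hi, rfl⟩ _ ⟨j, hj, rfl⟩
      classical
      refine gen_mul_comm ((D.tri.complex.isRelLowerSet_faces hs).2 ?_ ⟨i, by simp⟩)
      intro k hk
      rcases Finset.mem_insert.1 hk with rfl | hk
      · exact hσ hi
      · exact Finset.mem_singleton.1 hk ▸ hσ hj
    · rintro _ ⟨i, -, rfl⟩
      exact gen_mul_self _ i
  · rw [D.special_eq_bot hx]
    infer_instance

theorem point_eq_point_iff {w w' : D.W} {x x' : X} :
    D.point w x = D.point w' x' ↔ x = x' ∧ w⁻¹ * w' ∈ D.special x :=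
  Quotient.eq (r := D.setoid)

/-- Equality of classes splits into a condition on the base point and one on the Coxeter part; the
extension below is read off from this criterion. -/
theorem mem_stabilizer_point {w : D.W} {x : X} {a : D.WG} :
    a ∈ MulAction.stabilizer D.WG (D.point w x) ↔
      a.right ∈ D.stab x ∧ w⁻¹ * (a.left * D.φ a.right w) ∈ D.special x := by
  rw [MulAction.mem_stabilizer_iff, eq_comm]
  change D.point w x = D.point (a.left * D.φ a.right w) (D.act a.right x) ↔ _
  rw [point_eq_point_iff, eq_comm]
  rfl

/-- The short exact sequence `1 → W_x → Stab [w, x] → G_x → 1`. -/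
noncomputable def stabilizerExtension (w : D.W) (x : X) :
    GroupExtension (D.special x) (MulAction.stabilizer D.WG (D.point w x)) (D.stab x) where
  inl :=
    { toFun v := ⟨SemidirectProduct.inl (w * v * w⁻¹), D.mem_stabilizer_point.2
        ⟨one_mem _, by simp [mul_assoc]⟩⟩
      map_one' := Subtype.ext (by simp)
      map_mul' v v' := Subtype.ext (by
        simp only [Subgroup.coe_mul, ← map_mul]
        group) }
  rightHom :=
    { toFun a := ⟨a.1.right, (D.mem_stabilizer_point.1 a.2).1⟩
      map_one' := rfl
      map_mul' _ _ := rfl }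
  inl_injective v v' h := by
    have h' := SemidirectProduct.inl_injective (congrArg Subtype.val h)
    exact Subtype.ext (mul_left_cancel (mul_right_cancel h'))
  range_inl_eq_ker_rightHom := by
    ext a
    constructor
    · rintro ⟨v, rfl⟩
      rfl
    · intro ha
      have hr : a.1.right = 1 := congrArg Subtype.val ha
      have hl := (D.mem_stabilizer_point.1 a.2).2
      rw [hr, map_one, MulAut.one_apply] at hl
      -- For (u, 1) in the kernel the criterion says w⁻¹ u w ∈ W_x, and this element is the
      -- preimage.
      refine ⟨⟨_, hl⟩, Subtype.ext (SemidirectProduct.ext ?_ hr.symm)⟩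
      change w * (w⁻¹ * (a.1.left * w)) * w⁻¹ = a.1.left
      group
  rightHom_surjective g := by
    -- The Coxeter component is chosen to cancel w^γ, so that the pair (w, x) itself, not just its
    -- class, is preserved.
    refine ⟨⟨⟨w * (D.φ g.1 w)⁻¹, g.1⟩, D.mem_stabilizer_point.2 ⟨g.2, ?_⟩⟩, rfl⟩
    simp

theorem finite_stabilizer_point (w : D.W) (x : X) [Finite (D.stab x)] :
    Finite (MulAction.stabilizer D.WG (D.point w x)) := by
  have := D.finite_special x
  have hker : Finite (D.stabilizerExtension w x).rightHom.ker := by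
    rw [← (D.stabilizerExtension w x).range_inl_eq_ker_rightHom]
    exact Finite.of_surjective _ (D.stabilizerExtension w x).inl.rangeRestrict_surjective
  exact (MonoidHom.finite_iff_finite_ker_range (D.stabilizerExtension w x).rightHom).2
    ⟨hker, inferInstance⟩

/-- Off N the kernel W_x of the extension is trivial, so the projection to G is injective on the
stabilizer. -/
theorem card_stabilizer_point_le {w : D.W} {x : X} (hx : x ∉ D.N) [Finite (D.stab x)] :
    Nat.card (MulAction.stabilizer D.WG (D.point w x)) ≤ Nat.card (D.stab x) := by
  refine Nat.card_le_card_of_injective (D.stabilizerExtension w x).rightHom ?_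
  rw [← MonoidHom.ker_eq_bot_iff, ← (D.stabilizerExtension w x).range_inl_eq_ker_rightHom,
    eq_bot_iff]
  rintro _ ⟨v, rfl⟩
  have hv : v = 1 := Subtype.ext (Subgroup.mem_bot.1 (D.special_eq_bot hx ▸ v.2))
  rw [hv, map_one]
  exact one_mem _

end Datum

/-! ### Point stabilizers in the group of lifts -/

section Lifting

variable {X Y V V' : Type*} [TopologicalSpace X] [TopologicalSpace Y] {N : Set X}

/-- The stabilizer of a point in the group of lifts of the powers of `ω` embeds into the cyclic
group generated by `ω`. -/
theorem exists_injective_stab_liftDatum [PreconnectedSpace Y] {p : Y → X} (hp : IsCoveringMap p)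
    {T : Triangulation V N} {ω : X ≃ₜ X} (hω : T.IsSimplicial ω)
    {T' : Triangulation V' (p ⁻¹' N)} (hT : T'.IsLift T) (y : Y) :
    ∃ f : (liftDatum hp hω T' hT).stab y → Subgroup.zpowers ω, Function.Injective f := by
  -- For each γ some power of ω covered by γ is chosen. The resulting map need not be shown to be a
  -- homomorphism: injectivity is enough for counting.
  choose f hf hf' using fun γ : (liftDatum hp hω T' hT).stab y => γ.1.2
  refine ⟨fun γ => ⟨f γ, hf γ⟩, fun γ γ' h => Subtype.ext (Subtype.ext (Homeomorph.ext ?_))⟩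
  have hff : f γ = f γ' := congrArg Subtype.val h
  -- Two lifts of the same map that agree at the fixed point y agree everywhere, as the covering
  -- space is connected.
  refine congrFun (hp.eq_of_comp_eq γ.1.1.continuous γ'.1.1.continuous ?_ y ?_)
  · funext z
    simp only [Function.comp_apply, hf', hff]
  · exact (show γ.1.1 y = y from γ.2).trans (show γ'.1.1 y = y from γ'.2).symm

theorem finite_and_card_stab_liftDatum_le [PreconnectedSpace Y] {p : Y → X}
    (hp : IsCoveringMap p) {T : Triangulation V N} {ω : X ≃ₜ X} (hω₂ : ω * ω = 1)
    (hω : T.IsSimplicial ω) {T' : Triangulation V' (p ⁻¹' N)} (hT : T'.IsLift T) (y : Y) :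
    Finite ((liftDatum hp hω T' hT).stab y) ∧ Nat.card ((liftDatum hp hω T' hT).stab y) ≤ 2 := by
  obtain ⟨f, hf⟩ := exists_injective_stab_liftDatum hp hω hT y
  have hω₂' : ω ^ 2 = 1 := (sq ω).trans hω₂
  have : Finite (Subgroup.zpowers ω) :=
    finite_zpowers.2 (isOfFinOrder_iff_pow_eq_one.2 ⟨2, two_pos, hω₂'⟩)
  refine ⟨Finite.of_injective f hf, (Nat.card_le_card_of_injective f hf).trans ?_⟩
  rw [Nat.card_zpowers]
  exact Nat.le_of_dvd two_pos (orderOf_dvd_of_pow_eq_one hω₂')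

end Lifting

end ReflectionTrick

/-! ### The proposition -/

theorem mainTheorem6 {V V' M M' : Type*} [TopologicalSpace M] [TopologicalSpace M']
    [SimplyConnectedSpace M'] {p : M' → M} (hp : IsCoveringMap p) (hsurj : Function.Surjective p)
    {N : Set M} {T : ReflectionTrick.Triangulation V N}
    (hflag : ReflectionTrick.IsFlag T.complex)
    (hdim : ReflectionTrick.IsFiniteDimensional T.complex)
    {ω : M ≃ₜ M} (hω₂ : ω * ω = 1) (hω : T.IsSimplicial ω)
    {T' : ReflectionTrick.Triangulation V' (p ⁻¹' N)} (hT' : T'.IsLift T) :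
    let D := ReflectionTrick.liftDatum hp hω T' hT'
    (∀ (H : Subgroup D.WG) (u : D.U), (∀ h ∈ H, h • u = u) → Finite H) ∧
    (∀ (w : D.W) (x : M'), x ∉ p ⁻¹' N →
      Finite (MulAction.stabilizer D.WG (D.point w x)) ∧
      Nat.card (MulAction.stabilizer D.WG (D.point w x)) ≤ 2) ∧
    (∀ (w : D.W) (y : M'), y ∈ p ⁻¹' N →
      Finite (D.special y) ∧ Finite (D.stab y) ∧ Nat.card (D.stab y) ≤ 2 ∧
      ∃ S : GroupExtension (D.special y) (MulAction.stabilizer D.WG (D.point w y)) (D.stab y),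
        (∀ v, (S.inl v : D.WG) = SemidirectProduct.inl (w * v * w⁻¹)) ∧
        (∀ a, S.rightHom a = a.1.right)) := by
  intro D
  have hstab := ReflectionTrick.finite_and_card_stab_liftDatum_le hp hω₂ hω hT'
  have hfin (w : D.W) (x : M') : Finite (MulAction.stabilizer D.WG (D.point w x)) :=
    have : Finite (D.stab x) := (hstab x).1
    D.finite_stabilizer_point w x
  refine ⟨fun H u hH => ?_, fun w x hx => ⟨hfin w x, ?_⟩, fun w y _ => ?_⟩
  · obtain ⟨⟨w, x⟩, rfl⟩ := Quotient.exists_rep u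
    have := hfin w x
    -- Any H fixing u = [w, x] embeds into the full stabilizer of [w, x], which is finite.
    exact Finite.of_injective (fun h : H =>
      (⟨h.1, hH h.1 h.2⟩ : MulAction.stabilizer D.WG (D.point w x)))
      fun _ _ h => Subtype.ext (Subtype.mk.inj h)
  · have : Finite (D.stab x) := (hstab x).1
    exact (D.card_stabilizer_point_le hx).trans (hstab x).2
  · exact ⟨D.finite_special y, (hstab y).1, (hstab y).2, D.stabilizerExtension w y,
      fun _ => rfl, fun _ => rfl⟩
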